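/- Let $K\ge 1$ and let the network $\bigcup_{i=1}^K \overline{I_i}$ be $K$ copies of the half-line $\overline{I_i}=(-\infty,0]$ (with $I_i=(-\infty,0)$) glued at $0$; let $B\in\mathbb{R}$. Let $H_1,\dots,H_K:(-\infty,0]\times\mathbb{R}\to\mathbb{R}$ satisfy, for each $i$: (a) for every $R>0$, $H_i$ is Lipschitz continuous on $(-\infty,0]\times B(0,R)$; (b) $H_i(x,p)\to\infty$ as $|p|\to\infty$, uniformly in $x$; (c) for every $R>0$ there is $C_R>0$ with $|H_i(x,p)-H_i(y,p)|\le C_R(1+|p|)|x-y|$ whenever $|p|\le R$ and $x,y\le 0$; (d) $\sup\{|H_i(x,0)| : x\le 0\}<\infty$. For $k\in\{1,2\}$ let $C^k_*$ be the set of continuous functions on the network that are $C^1$ on each closed edge $\overline{I_i}$ and $C^k$ on each open edge $I_i$. A continuous function $u$ on the network is a viscosity solution of $$u+H_i(x,u_{x_i})=0\ \text{ in } I_i,\qquad \sum_{i=1}^K u_{x_i}=B\ \text{ at } 0 \tag{1}$$ if for every $\varphi\in C^1_*$ and every local maximum (resp. minimum) point $x$ of $u-\varphi$ one has $u(x)+H_i(x,\varphi_{x_i}(x))\le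 0$ (resp. $\ge 0$) when $x\in I_i$, and, when $x=0$, $\min\{\sum_i\varphi_{x_i}(0^-)-B,\ u(0)+\min_i H_i(0,\varphi_{x_i}(0^-))\}\le 0$ (resp. $\max\{\sum_i\varphi_{x_i}(0^-)-B,\ u(0)+\max_i H_i(0,\varphi_{x_i}(0^-))\}\ge 0$). For $\varepsilon>0$, a continuous function $u^\varepsilon$ is a viscosity solution of $$u^\varepsilon-\varepsilon u^\varepsilon_{x_ix_i}+H_i(x,u^\varepsilon_{x_i})=0\ \text{ in } I_i,\qquad \sum_{i=1}^K u^\varepsilon_{x_i}=B\ \text{ at } 0 \tag{2}$$ if for every $\varphi\in C^2_*$ and every local maximum (resp. minimum) point $x$ of $u^\varepsilon-\varphi$ one has $u^\varepsilon(x)-\varepsilon\varphi_{x_ix_i}(x)+H_i(x,\varphi_{x_i}(x))\le 0$ (resp. $\ge 0$) when $x\in I_i$, and $\sum_i\varphi_{x_i}(0^-)\le B$ (resp. $\ge B$) when $x=0$. Then there is a constant $C>0$, depending only on $K$, $B$ and the $H_i$, such that for every $\varepsilon>0$, if $u$ is a bounded viscosity solution of (1) and $u^\varepsilon$ is a bounded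 viscosity solution of (2), then $$\sup|u^\varepsilon-u|\le C\,\varepsilon^{1/2}.$$ -/

import Mathlib

open Set

noncomputable section

namespace Junction

/-- Points of the disjoint union of `K` copies of `(-∞, 0]` are identified when they are equal or
both are the end point `0` of their copy. -/
def glue (K : ℕ) : Setoid (Fin K × Iic (0 : ℝ)) where
  r a b := a = b ∨ ((a.2 : ℝ) = 0 ∧ (b.2 : ℝ) = 0)
  iseqv :=
    { refl := fun _ => Or.inl rfl
      symm := by
        rintro a b (h | ⟨h1, h2⟩)
        · exact Or.inl h.symm
        · exact Or.inr ⟨h2, h1⟩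
      trans := by
        rintro a b c (rfl | ⟨h1, h2⟩) (rfl | ⟨h3, h4⟩)
        · exact Or.inl rfl
        · exact Or.inr ⟨h3, h4⟩
        · exact Or.inr ⟨h1, h2⟩
        · exact Or.inr ⟨h1, h4⟩ }

/-- The network: `K` copies of the closed half-line `(-∞, 0]` glued at `0`. -/
def Network (K : ℕ) : Type := Quotient (glue K)

/-- The network carries the quotient topology. -/
instance (K : ℕ) : TopologicalSpace (Network K) :=
  inferInstanceAs (TopologicalSpace (Quotient (glue K)))

variable {K : ℕ}

/-- The point with coordinate `x ≤ 0` on the closed `i`-th edge. (Positive coordinates are not used;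
they are sent to the vertex.) -/
def edge (i : Fin K) (x : ℝ) : Network K :=
  Quotient.mk (glue K) (i, ⟨min x 0, min_le_right x 0⟩)

/-- The junction point, the common end point of all edges. -/
def vertex [NeZero K] : Network K := edge 0 0

/-- The derivative `φ_{x_i}(x)` along the `i`-th edge, `x ≤ 0`; at `x = 0` it is the one-sided
derivative `φ_{x_i}(0⁻)`. -/
def edgeSlope (φ : Network K → ℝ) (i : Fin K) (x : ℝ) : ℝ :=
  derivWithin (fun y => φ (edge i y)) (Iic 0) x

/-- The second derivative `φ_{x_i x_i}(x)` at an interior point `x < 0` of the `i`-th edge. -/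
def edgeSlope₂ (φ : Network K → ℝ) (i : Fin K) (x : ℝ) : ℝ :=
  deriv (deriv (fun y => φ (edge i y))) x

/-- The test functions `C^k_*`: continuous on the network, `C¹` on each closed edge (up to the
vertex) and `C^k` on each open edge. -/
def IsTest (k : ℕ) (φ : Network K → ℝ) : Prop :=
  Continuous φ ∧
    ∀ i, ContDiffOn ℝ 1 (fun y => φ (edge i y)) (Iic 0) ∧
      ContDiffOn ℝ k (fun y => φ (edge i y)) (Iio 0)

/-- Viscosity sub-solutions of `u + H_i(x, u_{x_i}) = 0` in `I_i`, `∑ u_{x_i} = B` at the vertex. -/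
def IsSubsolution [NeZero K] (H : Fin K → ℝ → ℝ → ℝ) (B : ℝ) (u : Network K → ℝ) : Prop :=
  UpperSemicontinuous u ∧
    ∀ φ : Network K → ℝ, IsTest 1 φ →
      (∀ i, ∀ x < 0, IsLocalMax (fun z => u z - φ z) (edge i x) →
        u (edge i x) + H i x (edgeSlope φ i x) ≤ 0) ∧
      (IsLocalMax (fun z => u z - φ z) vertex →
        min (∑ i, edgeSlope φ i 0 - B) (u vertex + ⨅ i, H i 0 (edgeSlope φ i 0)) ≤ 0)

/-- Viscosity super-solutions of `u + H_i(x, u_{x_i}) = 0` in `I_i`, `∑ u_{x_i} = B` at the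
vertex. -/
def IsSupersolution [NeZero K] (H : Fin K → ℝ → ℝ → ℝ) (B : ℝ) (u : Network K → ℝ) : Prop :=
  LowerSemicontinuous u ∧
    ∀ φ : Network K → ℝ, IsTest 1 φ →
      (∀ i, ∀ x < 0, IsLocalMin (fun z => u z - φ z) (edge i x) →
        0 ≤ u (edge i x) + H i x (edgeSlope φ i x)) ∧
      (IsLocalMin (fun z => u z - φ z) vertex →
        0 ≤ max (∑ i, edgeSlope φ i 0 - B) (u vertex + ⨆ i, H i 0 (edgeSlope φ i 0)))

/-- Viscosity solutions of the stationary Kirchhoff problem. -/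
def IsSolution [NeZero K] (H : Fin K → ℝ → ℝ → ℝ) (B : ℝ) (u : Network K → ℝ) : Prop :=
  Continuous u ∧ IsSubsolution H B u ∧ IsSupersolution H B u

/-- Viscosity sub-solutions of `u - ε u_{x_i x_i} + H_i(x, u_{x_i}) = 0` in `I_i`,
`∑ u_{x_i} = B` at the vertex. As `ε > 0`, the vertex condition needs no relaxation by the
equation: bending a test function at the vertex makes `-ε φ_{x_i x_i}` arbitrarily large there
while changing its slopes arbitrarily little. -/
def IsViscousSubsolution [NeZero K] (ε : ℝ) (H : Fin K → ℝ → ℝ → ℝ) (B : ℝ)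
    (u : Network K → ℝ) : Prop :=
  UpperSemicontinuous u ∧
    ∀ φ : Network K → ℝ, IsTest 2 φ →
      (∀ i, ∀ x < 0, IsLocalMax (fun z => u z - φ z) (edge i x) →
        u (edge i x) - ε * edgeSlope₂ φ i x + H i x (edgeSlope φ i x) ≤ 0) ∧
      (IsLocalMax (fun z => u z - φ z) vertex → ∑ i, edgeSlope φ i 0 ≤ B)

/-- Viscosity super-solutions of `u - ε u_{x_i x_i} + H_i(x, u_{x_i}) = 0` in `I_i`,
`∑ u_{x_i} = B` at the vertex. -/
def IsViscousSupersolution [NeZero K] (ε : ℝ) (H : Fin K → ℝ → ℝ → ℝ) (B : ℝ)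
    (u : Network K → ℝ) : Prop :=
  LowerSemicontinuous u ∧
    ∀ φ : Network K → ℝ, IsTest 2 φ →
      (∀ i, ∀ x < 0, IsLocalMin (fun z => u z - φ z) (edge i x) →
        0 ≤ u (edge i x) - ε * edgeSlope₂ φ i x + H i x (edgeSlope φ i x)) ∧
      (IsLocalMin (fun z => u z - φ z) vertex → B ≤ ∑ i, edgeSlope φ i 0)

/-- Viscosity solutions of the viscous Kirchhoff problem. -/
def IsViscousSolution [NeZero K] (ε : ℝ) (H : Fin K → ℝ → ℝ → ℝ) (B : ℝ)
    (u : Network K → ℝ) : Prop :=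
  Continuous u ∧ IsViscousSubsolution ε H B u ∧ IsViscousSupersolution ε H B u

/-- Bounded functions on the network. -/
def IsBounded (u : Network K → ℝ) : Prop := ∃ M : ℝ, ∀ z, |u z| ≤ M

end Junction

end

/-! Variables are doubled at the scale `s = √ε` on one edge at a time; the edges interact only
through the Kirchhoff condition at the very end. A bounded solution is bounded by a constant times
`1 + √ε` (`JetSuper.lower_bound` and its reflection), which already settles `ε ≥ 1`. For `ε ≤ 1`,
coercivity gives a Lipschitz constant `L` independent of `ε` (`JetSub.lipschitz`). In
`EdgePair.doubling` the penalty `(x - y + κ s)² / (2 s)` carries a shift with `κ = L + 1`. Its slope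
beats `L`, so the variable `x` of the super-solution `g` stays off the vertex. If the variable `y`
of the sub-solution `f` is also off the vertex, the equations give an error `O(s)`. Otherwise the
difference is large at the vertex, hence on every edge. Doubling again from the vertex, once as is
and once with the two functions reflected and exchanged, yields slopes `q` and `p` at which `h 0 r +
(f 0 + g 0) / 2` is positive and negative respectively. By the intermediate value theorem there are
slopes `t < t'` between them with `g 0 + h 0 r < 0 < f 0 + h 0 r`. These strict signs exclude
interior touching near the vertex, so both lines touch `f` from above and `g` from below at `0`
(`eventually_line_le`, `EdgePair.exists_separating_slopes`). Kirchhoff then gives `∑ t' ≤ B ≤ ∑ t`,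
a contradiction. -/

noncomputable section

namespace Junction

open Filter Topology

variable {K : ℕ}

/-! ### Test functions and neighbourhoods on the network -/

/-- The function on the network whose restriction to the `i`-th edge is `g i`. -/
def glueFun (g : Fin K → ℝ → ℝ) (hg : ∀ i j, g i 0 = g j 0) : Network K → ℝ :=
  Quotient.lift (fun a : Fin K × Iic (0 : ℝ) => g a.1 a.2) (by
    rintro ⟨i, x⟩ ⟨j, y⟩ (h | ⟨h1, h2⟩)
    · rw [h]
    · simp only at h1 h2
      simp only [h1, h2]
      exact hg i j)

theorem glueFun_edge (g : Fin K → ℝ → ℝ) (hg : ∀ i j, g i 0 = g j 0) (i : Fin K) {x : ℝ}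
    (hx : x ≤ 0) : glueFun g hg (edge i x) = g i x := by
  have : glueFun g hg (edge i x) = g i (min x 0) := rfl
  rw [this, min_eq_left hx]

theorem continuous_glueFun (g : Fin K → ℝ → ℝ) (hg : ∀ i j, g i 0 = g j 0)
    (hc : ∀ i, Continuous (g i)) : Continuous (glueFun g hg) := by
  refine Continuous.quotient_lift (s := glue K) ?_ _
  rw [continuous_prod_of_discrete_left]
  intro i
  exact (hc i).comp continuous_subtype_val

theorem continuous_edge (i : Fin K) : Continuous (edge i) := by
  refine continuous_quotient_mk'.comp ?_
  exact Continuous.prodMk continuous_const (by fun_prop)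

theorem edge_zero (i j : Fin K) : edge i 0 = edge j 0 :=
  Quotient.sound (Or.inr ⟨by simp, by simp⟩)

theorem edge_zero_eq_vertex [NeZero K] (i : Fin K) : edge i 0 = vertex := edge_zero i 0

theorem exists_eq_edge (z : Network K) : ∃ i, ∃ x ≤ 0, z = edge i x := by
  obtain ⟨⟨i, x⟩, rfl⟩ := Quotient.exists_rep z
  refine ⟨i, x, x.2, ?_⟩
  have h : (⟨min (x : ℝ) 0, min_le_right (x : ℝ) 0⟩ : Iic (0 : ℝ)) = x :=
    Subtype.ext (min_eq_left x.2)
  simp only [edge, h]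
  rfl

/-- The coordinate of the `i`-th edge, extended by `0` to the other edges, is continuous and
negative only on that edge. It therefore pulls neighbourhoods of `x` back to neighbourhoods inside
the open edge. -/
theorem eventually_nhds_edge {i : Fin K} {x : ℝ} (hx : x < 0) {S : Network K → Prop}
    (h : ∀ᶠ y in 𝓝 x, S (edge i y)) : ∀ᶠ z in 𝓝 (edge i x), S z := by
  classical
  set ρ : Network K → ℝ := glueFun (fun j y => if j = i then y else 0) (by simp) with hρ
  have hρc : Continuous ρ := by
    refine continuous_glueFun _ _ fun j => ?_
    by_cases hj : j = i
    · simp only [hj, if_true]; exact continuous_id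
    · simp only [hj, if_false]; exact continuous_const
  have hρx : ρ (edge i x) = x := by
    rw [hρ, glueFun_edge _ _ _ hx.le]; simp
  have h2 : ∀ᶠ y in 𝓝 (ρ (edge i x)), y < 0 ∧ S (edge i y) := by
    rw [hρx]; exact (gt_mem_nhds hx).and h
  filter_upwards [hρc.continuousAt.eventually h2] with z hz
  obtain ⟨j, y, hy, rfl⟩ := exists_eq_edge z
  rw [hρ, glueFun_edge _ _ _ hy] at hz
  by_cases hj : j = i
  · subst hj; simpa using hz.2
  · simp [hj] at hz

/-- Pull back along the coordinate common to all edges; finitely many edges make the conditions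
simultaneous. -/
theorem eventually_nhds_vertex [NeZero K] {S : Network K → Prop}
    (h : ∀ i, ∀ᶠ y in 𝓝[≤] (0 : ℝ), S (edge i y)) : ∀ᶠ z in 𝓝 (vertex : Network K), S z := by
  set ρ : Network K → ℝ := glueFun (fun _ y => y) (by simp) with hρ
  have hρc : Continuous ρ := continuous_glueFun _ _ fun j => continuous_id
  have hρx : ρ vertex = 0 := by
    rw [hρ, vertex, glueFun_edge _ _ _ le_rfl]
  have h2 : ∀ᶠ y in 𝓝 (ρ vertex), ∀ i, y ≤ 0 → S (edge i y) := by
    rw [hρx, eventually_all]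
    intro i
    exact eventually_nhdsWithin_iff.1 (h i)
  filter_upwards [hρc.continuousAt.eventually h2] with z hz
  obtain ⟨j, y, hy, rfl⟩ := exists_eq_edge z
  rw [hρ, glueFun_edge _ _ _ hy] at hz
  exact hz j hy

theorem isTest_glueFun (k : ℕ) (hk : 1 ≤ k) (g : Fin K → ℝ → ℝ) (hg : ∀ i j, g i 0 = g j 0)
    (hs : ∀ i, ContDiff ℝ k (g i)) : IsTest k (glueFun g hg) := by
  refine ⟨continuous_glueFun g hg fun i => (hs i).continuous, fun i => ⟨?_, ?_⟩⟩
  · exact ((hs i).of_le (by exact_mod_cast hk)).contDiffOn.congr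
      fun y hy => glueFun_edge g hg i hy
  · exact (hs i).contDiffOn.congr fun y hy => glueFun_edge g hg i (le_of_lt hy)

theorem edgeSlope_glueFun (g : Fin K → ℝ → ℝ) (hg : ∀ i j, g i 0 = g j 0) (i : Fin K) {x a : ℝ}
    (hx : x ≤ 0) (hd : HasDerivAt (g i) a x) : edgeSlope (glueFun g hg) i x = a := by
  unfold edgeSlope
  rw [derivWithin_congr (s := Iic 0) (f := g i) (fun y hy => glueFun_edge g hg i hy) (glueFun_edge g hg i hx)]
  exact hd.hasDerivWithinAt.derivWithin (uniqueDiffOn_Iic 0 x hx)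

theorem edgeSlope₂_glueFun (g : Fin K → ℝ → ℝ) (hg : ∀ i j, g i 0 = g j 0) (i : Fin K) {x : ℝ}
    (hx : x < 0) : edgeSlope₂ (glueFun g hg) i x = deriv (deriv (g i)) x := by
  unfold edgeSlope₂
  have h : (fun y => glueFun g hg (edge i y)) =ᶠ[𝓝 x] g i := by
    filter_upwards [gt_mem_nhds hx] with y hy
    exact glueFun_edge g hg i (le_of_lt hy)
  exact h.deriv.deriv_eq

/-- The quadratic polynomial with slope `a` and second derivative `2 * b` at `x`, extended by
a constant to the edges other than the `i`-th one. -/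
def jetFun (i : Fin K) (x a b : ℝ) : Fin K → ℝ → ℝ := fun j y =>
  if j = i then a * (y - x) + b * (y - x) ^ 2 else a * (0 - x) + b * (0 - x) ^ 2

theorem jetFun_zero (i : Fin K) (x a b : ℝ) (j k : Fin K) :
    jetFun i x a b j 0 = jetFun i x a b k 0 := by
  simp [jetFun]

theorem contDiff_jetFun (i : Fin K) (x a b : ℝ) (k : ℕ) (j : Fin K) :
    ContDiff ℝ k (jetFun i x a b j) := by
  unfold jetFun
  by_cases hj : j = i
  · simp only [hj, if_true]; fun_prop
  · simp only [hj, if_false]; fun_prop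

theorem hasDerivAt_jetFun (i : Fin K) (x a b y : ℝ) :
    HasDerivAt (jetFun i x a b i) (a + 2 * b * (y - x)) y := by
  have h1 : HasDerivAt (fun y : ℝ => y - x) 1 y := (hasDerivAt_id y).sub_const x
  have h2 := (h1.const_mul a).add ((h1.pow 2).const_mul b)
  have h3 : jetFun i x a b i = (fun y => a * (y - x)) + fun y => b * ((fun y => y - x) ^ 2) y := by
    ext y; simp [jetFun]
  rw [h3]
  refine h2.congr_deriv ?_
  simp
  ring

theorem deriv_deriv_jetFun (i : Fin K) (x a b : ℝ) :
    deriv (deriv (jetFun i x a b i)) x = 2 * b := by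
  have h : deriv (jetFun i x a b i) = fun y => a + 2 * b * (y - x) :=
    funext fun y => (hasDerivAt_jetFun i x a b y).deriv
  rw [h]
  have h1 : HasDerivAt (fun y : ℝ => a + 2 * b * (y - x)) (2 * b * 1) x :=
    (((hasDerivAt_id x).sub_const x).const_mul (2 * b)).const_add a
  rw [h1.deriv, mul_one]

theorem edgeSlope_jetFun (i : Fin K) {x : ℝ} (hx : x < 0) (a b : ℝ) :
    edgeSlope (glueFun (jetFun i x a b) (jetFun_zero i x a b)) i x = a := by
  have h := hasDerivAt_jetFun i x a b x
  simp only [sub_self, mul_zero, add_zero] at h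
  exact edgeSlope_glueFun _ _ i hx.le h

theorem glueFun_jetFun_edge (i : Fin K) (x a b : ℝ) {y : ℝ} (hy : y < 0) :
    glueFun (jetFun i x a b) (jetFun_zero i x a b) (edge i y) =
      a * (y - x) + b * (y - x) ^ 2 := by
  rw [glueFun_edge _ _ _ hy.le]; simp [jetFun]

/-! ### Solutions tested by jets and by vertex slopes -/

/-- `f` has an upper quadratic jet with slope `a` and second derivative `2 * b` at `x`. -/
def UpperJet (f : ℝ → ℝ) (x a b : ℝ) : Prop :=
  ∀ᶠ y in 𝓝 x, f y ≤ f x + a * (y - x) + b * (y - x) ^ 2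

/-- `f` has a lower quadratic jet with slope `a` and second derivative `2 * b` at `x`. -/
def LowerJet (f : ℝ → ℝ) (x a b : ℝ) : Prop :=
  ∀ᶠ y in 𝓝 x, f x + a * (y - x) + b * (y - x) ^ 2 ≤ f y

theorem UpperJet.isLocalMax {u : Network K → ℝ} {i : Fin K} {x a b : ℝ} (hx : x < 0)
    (h : UpperJet (fun y => u (edge i y)) x a b) :
    IsLocalMax (fun z => u z - glueFun (jetFun i x a b) (jetFun_zero i x a b) z) (edge i x) := by
  refine eventually_nhds_edge hx ?_
  filter_upwards [h, gt_mem_nhds hx] with y hy hy0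
  rw [glueFun_jetFun_edge i x a b hy0, glueFun_jetFun_edge i x a b hx]
  simp only [sub_self]
  linarith

theorem LowerJet.isLocalMin {u : Network K → ℝ} {i : Fin K} {x a b : ℝ} (hx : x < 0)
    (h : LowerJet (fun y => u (edge i y)) x a b) :
    IsLocalMin (fun z => u z - glueFun (jetFun i x a b) (jetFun_zero i x a b) z) (edge i x) := by
  refine eventually_nhds_edge hx ?_
  filter_upwards [h, gt_mem_nhds hx] with y hy hy0
  rw [glueFun_jetFun_edge i x a b hy0, glueFun_jetFun_edge i x a b hx]
  simp only [sub_self]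
  linarith

/-- Sub-solutions, tested by quadratic polynomials on the edges and by linear functions at the
vertex, where the latter have to satisfy strict inequalities in the equations. -/
structure JetSub (ε : ℝ) (H : Fin K → ℝ → ℝ → ℝ) (B : ℝ) (U : Fin K → ℝ → ℝ) : Prop where
  edge_le : ∀ i, ∀ x < 0, ∀ a b, UpperJet (U i) x a b → U i x - 2 * ε * b + H i x a ≤ 0
  vertex_le : ∀ t : Fin K → ℝ, (∀ i, ∀ᶠ y in 𝓝[≤] (0 : ℝ), U i y ≤ U i 0 + t i * y) →
    (∀ i, 0 < U i 0 + H i 0 (t i)) → ∑ i, t i ≤ B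

/-- Super-solutions, tested by quadratic polynomials on the edges and by linear functions at the
vertex, where the latter have to satisfy strict inequalities in the equations. -/
structure JetSuper (ε : ℝ) (H : Fin K → ℝ → ℝ → ℝ) (B : ℝ) (U : Fin K → ℝ → ℝ) : Prop where
  le_edge : ∀ i, ∀ x < 0, ∀ a b, LowerJet (U i) x a b → 0 ≤ U i x - 2 * ε * b + H i x a
  le_vertex : ∀ t : Fin K → ℝ, (∀ i, ∀ᶠ y in 𝓝[≤] (0 : ℝ), U i 0 + t i * y ≤ U i y) →
    (∀ i, U i 0 + H i 0 (t i) < 0) → B ≤ ∑ i, t i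

variable {ε B : ℝ} {H : Fin K → ℝ → ℝ → ℝ}

/-- The Hamiltonian satisfied by the negative of a solution. -/
def reflect (H : Fin K → ℝ → ℝ → ℝ) : Fin K → ℝ → ℝ → ℝ := fun i x p => -H i x (-p)

theorem UpperJet.neg_lowerJet {f : ℝ → ℝ} {x a b : ℝ} (h : UpperJet (fun y => -f y) x a b) :
    LowerJet f x (-a) (-b) := by
  unfold UpperJet LowerJet at *
  filter_upwards [h] with y hy
  linarith

theorem LowerJet.neg_upperJet {f : ℝ → ℝ} {x a b : ℝ} (h : LowerJet (fun y => -f y) x a b) :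
    UpperJet f x (-a) (-b) := by
  unfold UpperJet LowerJet at *
  filter_upwards [h] with y hy
  linarith

theorem JetSuper.neg {U : Fin K → ℝ → ℝ} (h : JetSuper ε H B U) :
    JetSub ε (reflect H) (-B) (fun i x => -U i x) where
  edge_le i x hx a b hj := by
    have := h.le_edge i x hx _ _ hj.neg_lowerJet
    simp only [reflect]
    linarith
  vertex_le t ht h0 := by
    have := h.le_vertex (fun i => -t i)
      (fun i => by filter_upwards [ht i] with y hy; linarith)
      (fun i => by have := h0 i; simp only [reflect] at this; linarith)
    rw [Finset.sum_neg_distrib] at this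
    linarith

/-- Lets the lower bound for super-solutions serve as an upper bound for sub-solutions. -/
theorem JetSub.neg {U : Fin K → ℝ → ℝ} (h : JetSub ε H B U) :
    JetSuper ε (reflect H) (-B) (fun i x => -U i x) where
  le_edge i x hx a b hj := by
    have := h.edge_le i x hx _ _ hj.neg_upperJet
    simp only [reflect]
    linarith
  le_vertex t ht h0 := by
    have := h.vertex_le (fun i => -t i)
      (fun i => by filter_upwards [ht i] with y hy; linarith)
      (fun i => by have := h0 i; simp only [reflect] at this; linarith)
    rw [Finset.sum_neg_distrib] at this
    linarith

/-- The functions that are linear on each edge and vanish at the vertex. -/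
def slopeFun (t : Fin K → ℝ) : Network K → ℝ := glueFun (fun i y => t i * y) (by simp)

theorem isTest_slopeFun (t : Fin K → ℝ) (k : ℕ) (hk : 1 ≤ k) : IsTest k (slopeFun t) :=
  isTest_glueFun k hk _ _ fun i => by fun_prop

theorem edgeSlope_slopeFun (t : Fin K → ℝ) (i : Fin K) : edgeSlope (slopeFun t) i 0 = t i :=
  edgeSlope_glueFun _ _ i le_rfl (by simpa using (hasDerivAt_id (0 : ℝ)).const_mul (t i))

variable [NeZero K]

theorem slopeFun_vertex (t : Fin K → ℝ) : slopeFun t vertex = 0 := by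
  simp [slopeFun, vertex, glueFun_edge]

theorem isLocalMax_sub_slopeFun {u : Network K → ℝ} {t : Fin K → ℝ}
    (h : ∀ i, ∀ᶠ y in 𝓝[≤] (0 : ℝ), u (edge i y) ≤ u (edge i 0) + t i * y) :
    IsLocalMax (fun z => u z - slopeFun t z) vertex := by
  refine eventually_nhds_vertex fun i => ?_
  filter_upwards [h i, self_mem_nhdsWithin] with y hy hy0
  rw [slopeFun_vertex, slopeFun, glueFun_edge _ _ _ hy0, ← edge_zero_eq_vertex i]
  linarith

theorem isLocalMin_sub_slopeFun {u : Network K → ℝ} {t : Fin K → ℝ}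
    (h : ∀ i, ∀ᶠ y in 𝓝[≤] (0 : ℝ), u (edge i 0) + t i * y ≤ u (edge i y)) :
    IsLocalMin (fun z => u z - slopeFun t z) vertex := by
  refine eventually_nhds_vertex fun i => ?_
  filter_upwards [h i, self_mem_nhdsWithin] with y hy hy0
  rw [slopeFun_vertex, slopeFun, glueFun_edge _ _ _ hy0, ← edge_zero_eq_vertex i]
  linarith

variable {u : Network K → ℝ}

/-- The strict inequalities demanded of vertex slopes rule out the equation branch of the relaxed
condition, so only the Kirchhoff branch is left. This puts the inviscid and viscous problems in one
form. -/
theorem IsSubsolution.jetSub (hu : IsSubsolution H B u) :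
    JetSub 0 H B (fun i x => u (edge i x)) where
  edge_le i x hx a b h := by
    have h1 := (hu.2 _ (isTest_glueFun 1 le_rfl _ (jetFun_zero i x a b)
      (contDiff_jetFun i x a b 1))).1 i x hx (h.isLocalMax hx)
    rw [edgeSlope_jetFun i hx] at h1
    linarith
  vertex_le t h ht := by
    have h1 := (hu.2 _ (isTest_slopeFun t 1 le_rfl)).2 (isLocalMax_sub_slopeFun h)
    simp only [edgeSlope_slopeFun] at h1
    obtain ⟨i, hi⟩ := exists_eq_ciInf_of_finite (f := fun i => H i 0 (t i))
    have h2 := ht i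
    rw [← hi, ← edge_zero_eq_vertex i] at h1
    rcases min_le_iff.1 h1 with h3 | h3 <;> linarith

theorem IsSupersolution.jetSuper (hu : IsSupersolution H B u) :
    JetSuper 0 H B (fun i x => u (edge i x)) where
  le_edge i x hx a b h := by
    have h1 := (hu.2 _ (isTest_glueFun 1 le_rfl _ (jetFun_zero i x a b)
      (contDiff_jetFun i x a b 1))).1 i x hx (h.isLocalMin hx)
    rw [edgeSlope_jetFun i hx] at h1
    linarith
  le_vertex t h ht := by
    have h1 := (hu.2 _ (isTest_slopeFun t 1 le_rfl)).2 (isLocalMin_sub_slopeFun h)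
    simp only [edgeSlope_slopeFun] at h1
    obtain ⟨i, hi⟩ := exists_eq_ciSup_of_finite (f := fun i => H i 0 (t i))
    have h2 := ht i
    rw [← hi, ← edge_zero_eq_vertex i] at h1
    rcases le_max_iff.1 h1 with h3 | h3 <;> linarith

theorem IsViscousSubsolution.jetSub (hu : IsViscousSubsolution ε H B u) :
    JetSub ε H B (fun i x => u (edge i x)) where
  edge_le i x hx a b h := by
    have h1 := (hu.2 _ (isTest_glueFun 2 one_le_two _ (jetFun_zero i x a b)
      (contDiff_jetFun i x a b 2))).1 i x hx (h.isLocalMax hx)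
    rw [edgeSlope_jetFun i hx, edgeSlope₂_glueFun _ _ i hx, deriv_deriv_jetFun] at h1
    linarith
  vertex_le t h ht := by
    have h1 := (hu.2 _ (isTest_slopeFun t 2 one_le_two)).2 (isLocalMax_sub_slopeFun h)
    simpa only [edgeSlope_slopeFun] using h1

theorem IsViscousSupersolution.jetSuper (hu : IsViscousSupersolution ε H B u) :
    JetSuper ε H B (fun i x => u (edge i x)) where
  le_edge i x hx a b h := by
    have h1 := (hu.2 _ (isTest_glueFun 2 one_le_two _ (jetFun_zero i x a b)
      (contDiff_jetFun i x a b 2))).1 i x hx (h.isLocalMin hx)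
    rw [edgeSlope_jetFun i hx, edgeSlope₂_glueFun _ _ i hx, deriv_deriv_jetFun] at h1
    linarith
  le_vertex t h ht := by
    have h1 := (hu.2 _ (isTest_slopeFun t 2 one_le_two)).2 (isLocalMin_sub_slopeFun h)
    simpa only [edgeSlope_slopeFun] using h1

end Junction

end

/-! ### A priori bounds and Lipschitz estimates -/

noncomputable section

namespace Junction

open Filter Topology

/-- Far to the left the values do not beat `f x₀`, so a minimum over a compact interval containing
`x₀` is global. -/
theorem exists_forall_le_of_Iic {f : ℝ → ℝ} {b x₀ R : ℝ} (hf : ContinuousOn f (Iic b))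
    (hx₀ : x₀ ≤ b) (hR : ∀ x ≤ -R, f x₀ ≤ f x) : ∃ x ≤ b, ∀ y ≤ b, f x ≤ f y := by
  obtain ⟨x, hx, hmin⟩ := (isCompact_Icc (a := min (-R) x₀) (b := b)).exists_isMinOn
    ⟨x₀, min_le_right _ _, hx₀⟩ (hf.mono Icc_subset_Iic_self)
  refine ⟨x, hx.2, fun y hy => ?_⟩
  by_cases h : min (-R) x₀ ≤ y
  · exact hmin ⟨h, hy⟩
  · exact (hmin (⟨min_le_right _ _, hx₀⟩ : x₀ ∈ Icc _ _)).trans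
      (hR y ((not_le.1 h).le.trans (min_le_left _ _)))

theorem lowerJet_of_forall_le {f : ℝ → ℝ} {x p c : ℝ} (hx : x < 0)
    (h : ∀ y ≤ 0, f x + p * x + c * x ^ 2 ≤ f y + p * y + c * y ^ 2) :
    LowerJet f x (-(p + 2 * c * x)) (-c) := by
  filter_upwards [gt_mem_nhds hx] with y hy
  have := h y (le_of_lt hy)
  linarith

variable {K : ℕ} {ε B : ℝ} {H : Fin K → ℝ → ℝ → ℝ} {U : Fin K → ℝ → ℝ}

/-- A super-solution that is bounded below is at least `-C (1 + √ε)`. -/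
theorem JetSuper.lower_bound [NeZero K] (h : JetSuper ε H B U) (hε : 0 ≤ ε)
    (h0 : ∀ i j, U i 0 = U j 0) (hc : ∀ i, ContinuousOn (U i) (Iic 0)) {m A : ℝ}
    (hm : ∀ i, ∀ x ≤ 0, m ≤ U i x)
    (hA : ∀ i, ∀ x ≤ 0, ∀ p, |p| ≤ |B| + 4 → |H i x p| ≤ A) (i : Fin K) {x : ℝ} (hx : x ≤ 0) :
    -(A + ((|B| + 2) ^ 2 + 3) * (1 + √ε)) ≤ U i x := by
  set s := √ε with hs
  have hs0 : 0 ≤ s := Real.sqrt_nonneg _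
  have hs2 : s ^ 2 = ε := Real.sq_sqrt hε
  -- The curvature is small enough that the viscous term obeys `2 ε c ≤ 2 s`, and large enough that
  -- the penalty exceeds the gap `1` at distance `1 + s`.
  set c := (1 + s)⁻¹ with hcdef
  have hc0 : 0 < c := by positivity
  have hcs : c * (1 + s) = 1 := inv_mul_cancel₀ (by positivity)
  have hc1 : c ≤ 1 := by nlinarith
  have hεc : ε * c ≤ s := by rw [← hs2]; nlinarith
  set b := |B| + 2 with hb
  have hB := abs_nonneg B
  -- The infimum need not be attained; a point within `1` of it suffices.
  obtain ⟨i₀, z, hz, hnear⟩ : ∃ i₀, ∃ z ≤ 0, ∀ j, ∀ y ≤ 0, U i₀ z ≤ U j y + 1 := by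
    set S : Set ℝ := {r | ∃ j, ∃ y ≤ 0, r = U j y}
    have hSb : BddBelow S := ⟨m, by rintro _ ⟨j, y, hy, rfl⟩; exact hm j y hy⟩
    obtain ⟨r, ⟨j, y, hy, rfl⟩, hlt⟩ := exists_lt_of_csInf_lt
      (s := S) ⟨_, i, x, hx, rfl⟩ (lt_add_one (sInf S))
    refine ⟨j, y, hy, fun k w hw => ?_⟩
    have := csInf_le hSb ⟨k, w, hw, rfl⟩
    linarith
  suffices hmain : -(A + (b ^ 2 + 2) * (1 + s)) ≤ U i₀ z by
    have := hnear i x hx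
    nlinarith
  -- This is the penalty `c (y - z)²` without its constant term.
  obtain ⟨x₁, hx₁, hmin⟩ := exists_forall_le_of_Iic (b := 0) (x₀ := z) (R := -z + (1 + s))
    (f := fun y => U i₀ y + (-2 * c * z) * y + c * y ^ 2)
    (((hc i₀).add (by fun_prop)).add (by fun_prop)) hz (by
      intro y hy
      have h1 := hnear i₀ y (by linarith)
      have h2 : 1 ≤ c * (y - z) ^ 2 := by
        have h3 : (1 + s) ^ 2 ≤ (y - z) ^ 2 := by nlinarith
        nlinarith [mul_le_mul_of_nonneg_left h3 hc0.le]
      nlinarith)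
  have hx₁z : U i₀ x₁ + c * (x₁ - z) ^ 2 ≤ U i₀ z := by have := hmin z hz; nlinarith
  rcases hx₁.lt_or_eq with hx₁' | hx₁'
  · have h1 := h.le_edge i₀ x₁ hx₁' _ _ (lowerJet_of_forall_le hx₁' hmin)
    have h2 : c * (x₁ - z) ^ 2 ≤ 1 := by have := hnear i₀ x₁ hx₁; linarith
    have h3 := hA i₀ x₁ hx₁ (-(-2 * c * z + 2 * c * x₁)) (by
      apply abs_le_of_sq_le_sq _ (by positivity)
      nlinarith)
    have h4 := (abs_le.1 h3).2
    have h5 : 0 ≤ c * (x₁ - z) ^ 2 := by positivity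
    nlinarith
  -- The vertex value is now itself within `1` of the infimum. Adding `b y + c y²` on every edge
  -- tests slopes too negative for the Kirchhoff condition.
  · subst hx₁'
    have hnear0 : ∀ j, ∀ y ≤ 0, U j 0 ≤ U j y + 1 := fun j y hy => by
      have h1 := hnear j y hy
      have h2 : 0 ≤ c * (0 - z) ^ 2 := by positivity
      rw [h0 j i₀]
      linarith
    have hz0 : U i₀ 0 ≤ U i₀ z := by
      have h2 : 0 ≤ c * (0 - z) ^ 2 := by positivity
      linarith
    have hex : ∀ j, ∃ y ≤ 0, ∀ w ≤ 0, U j y + b * y + c * y ^ 2 ≤ U j w + b * w + c * w ^ 2 := by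
      intro j
      refine exists_forall_le_of_Iic (b := 0) (x₀ := 0) (R := (b + 1) * (1 + s))
        (((hc j).add (by fun_prop)).add (by fun_prop)) le_rfl fun y hy => ?_
      have h1 := hnear0 j y (by nlinarith)
      have h2 : c * y ≤ -(b + 1) := by nlinarith
      have h3 : y ≤ -1 := by nlinarith
      nlinarith
    by_cases hall : ∀ j, ∀ w ≤ 0, U j 0 ≤ U j w + b * w + c * w ^ 2
    -- The slopes `-(|B| + 1)` sum to less than `B`, so the equation cannot be strictly negative on
    -- all edges at the vertex; one edge then gives the bound.
    · have hv := mt (h.le_vertex (fun _ => -(|B| + 1)) (fun j => by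
        filter_upwards [self_mem_nhdsWithin, mem_nhdsWithin_of_mem_nhds
          (lt_mem_nhds (show (-1 : ℝ) < 0 by norm_num))] with y hy hy1
        have hy0 : y ≤ 0 := hy
        have := hall j y hy
        nlinarith [mul_nonneg (neg_nonneg.2 hy0) (show 0 ≤ 1 + c * y by nlinarith)]))
      have hK : ¬ B ≤ ∑ _i : Fin K, -(|B| + 1) := by
        have h1 : (1 : ℝ) ≤ K := by exact_mod_cast NeZero.one_le
        simp only [Finset.sum_const, Finset.card_univ, Fintype.card_fin, nsmul_eq_mul]
        have h2 := neg_abs_le B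
        push Not
        nlinarith
      have := hv hK
      push Not at this
      obtain ⟨j, hj⟩ := this
      have h2 := (abs_le.1 (hA j 0 le_rfl (-(|B| + 1)) (by
        rw [abs_neg, abs_of_nonneg (by linarith)]; linarith))).2
      rw [h0 j i₀] at hj
      nlinarith [sq_nonneg b]
    -- Some edge has its penalised minimum strictly inside, where the edge equation applies.
    · push Not at hall
      obtain ⟨j, w, hw, hlt⟩ := hall
      obtain ⟨y, hy, hymin⟩ := hex j
      have hy0 : y < 0 := by
        rcases hy.lt_or_eq with h1 | h1
        · exact h1
        · have := hymin w hw
          rw [h1] at this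
          linarith
      have h1 := h.le_edge j y hy0 _ _ (lowerJet_of_forall_le hy0 hymin)
      have h2 := hymin 0 le_rfl
      have h3 := hnear0 j y hy
      have h4 : b * y + c * y ^ 2 ≤ 1 := by linarith
      have h5 := (abs_le.1 (hA j y hy (-(b + 2 * c * y)) (by
        apply abs_le_of_sq_le_sq _ (by positivity)
        have : |B| + 4 = b + 2 := by rw [hb]; ring
        rw [this]
        nlinarith))).2
      have h6 : -(b ^ 2 * (1 + s)) ≤ b * y + c * y ^ 2 := by
        have : b * y + c * y ^ 2 + b ^ 2 * (1 + s) =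
          c * (y + b * (1 + s) / 2) ^ 2 + b ^ 2 * (1 + s) * 3 / 4 := by
          have : b ^ 2 * (1 + s) ^ 2 * c = b ^ 2 * (1 + s) := by
            linear_combination b ^ 2 * (1 + s) * hcs
          linear_combination (-b * y) * hcs - this / 4
        have h7 : 0 ≤ c * (y + b * (1 + s) / 2) ^ 2 + b ^ 2 * (1 + s) * 3 / 4 := by positivity
        linarith
      rw [← h0 j i₀] at hz0
      linarith

/-- A bounded sub-solution of a coercive equation is Lipschitz continuous. -/
theorem JetSub.lipschitz (h : JetSub ε H B U)
    (hc : ∀ i, ContinuousOn (U i) (Iic 0)) {N M P : ℝ} (hN : ∀ i, ∀ x ≤ 0, U i x ≤ N)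
    (hM : ∀ i, ∀ x ≤ 0, -M ≤ U i x) (hP : 0 < P)
    (hH : ∀ i, ∀ x ≤ 0, ∀ p, P ≤ |p| → M < H i x p) (i : Fin K) {x y : ℝ} (hx : x ≤ 0)
    (hy : y ≤ 0) : |U i x - U i y| ≤ (P * K + |B| + 1) * |x - y| := by
  -- Chosen so that slope `Q` on one edge and `-P` on the others sum to `P + |B| + 1 > B`.
  set Q := P * K + |B| + 1 with hQ
  have hK : (1 : ℝ) ≤ K := by exact_mod_cast i.pos
  have hPQ : P ≤ Q := by have := abs_nonneg B; nlinarith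
  -- Testing by lines removes the viscous term, so the constant does not depend on `ε`.
  have hedge : ∀ j, ∀ w < 0, ∀ a, P ≤ |a| → ¬ UpperJet (U j) w a 0 := by
    intro j w hw a ha hj
    have h1 := h.edge_le j w hw a 0 hj
    have h2 := hH j w hw.le a ha
    have h3 := hM j w hw.le
    linarith
  -- If this failed, `U j r + P r` would have a maximum over `r ≤ w` strictly left of `w`, against
  -- coercivity.
  have hdown : ∀ j, ∀ w ≤ 0, ∀ v ≤ w, U j v ≤ U j w + P * (w - v) := by
    intro j w hw v hv
    by_contra! hlt
    obtain ⟨r, hr, hmin⟩ := exists_forall_le_of_Iic (b := w) (x₀ := w)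
      (R := (N - U j w) / P - w) (f := fun r => -(U j r + P * r))
      (((hc j).mono (Iic_subset_Iic.2 hw)).add (by fun_prop)).neg le_rfl (by
        intro r hr
        have h3 : 0 ≤ (N - U j w) / P := div_nonneg (by linarith [hN j w hw]) hP.le
        have h1 := hN j r (by linarith)
        have h2 : P * ((N - U j w) / P) = N - U j w := by field_simp
        nlinarith)
    have hrw : r < w := by
      rcases hr.lt_or_eq with h1 | h1
      · exact h1
      · have := hmin v hv
        rw [h1] at this
        linarith
    refine hedge j r (hrw.trans_le hw) (-P) (by rw [abs_neg, abs_of_pos hP]) ?_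
    filter_upwards [gt_mem_nhds hrw] with q hq
    have := hmin q hq.le
    linarith
  -- In this direction the maximum on `[v, 0]` may sit at the vertex; Kirchhoff excludes that, with
  -- `hdown` supplying the slopes on the other edges.
  have hup : ∀ w ≤ 0, ∀ v ≤ w, U i w ≤ U i v + Q * (w - v) := by
    intro w hw v hv
    by_contra! hlt
    obtain ⟨r, hr, hmax⟩ := (isCompact_Icc (a := v) (b := 0)).exists_isMaxOn
      ⟨w, hv, hw⟩ (f := fun r => U i r - Q * r)
      (((hc i).mono Icc_subset_Iic_self).sub (by fun_prop))
    have hmax' : ∀ q, v ≤ q → q ≤ 0 → U i q - Q * q ≤ U i r - Q * r :=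
      fun q h1 h2 => hmax ⟨h1, h2⟩
    have hvr : v < r := by
      rcases hr.1.lt_or_eq with h1 | h1
      · exact h1
      · have := hmax' w hv hw
        rw [← h1] at this
        linarith
    rcases hr.2.lt_or_eq with hr0 | rfl
    · refine hedge i r hr0 Q (hPQ.trans (le_abs_self _)) ?_
      filter_upwards [gt_mem_nhds hr0, lt_mem_nhds hvr] with q hq0 hq
      have := hmax' q hq.le hq0.le
      linarith
    · classical
      have hv := h.vertex_le (fun j => if j = i then Q else -P) (by
        intro j
        by_cases hj : j = i
        · subst hj
          filter_upwards [self_mem_nhdsWithin, mem_nhdsWithin_of_mem_nhds (lt_mem_nhds hvr)]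
            with q hq0 hq
          have := hmax' q hq.le hq0
          simp only [if_true]
          linarith
        · filter_upwards [self_mem_nhdsWithin] with q hq0
          have := hdown j 0 le_rfl q hq0
          simp only [hj, if_false]
          linarith) (by
        intro j
        have h1 := hM j 0 le_rfl
        have h2 := hH j 0 le_rfl (if j = i then Q else -P) (by
          split_ifs
          · exact hPQ.trans (le_abs_self _)
          · rw [abs_neg, abs_of_pos hP])
        linarith)
      have hsum : ∑ j, (if j = i then Q else -P) = Q + P - K * P := by
        have : ∀ j, (if j = i then Q else -P) = (if j = i then Q + P else 0) + -P := by
          intro j; split_ifs <;> ring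
        simp only [this, Finset.sum_add_distrib, Finset.sum_ite_eq', Finset.mem_univ, if_true,
          Finset.sum_const, Finset.card_univ, Fintype.card_fin, nsmul_eq_mul]
        ring
      rw [hsum] at hv
      have := le_abs_self B
      nlinarith
  rcases le_total x y with hxy | hxy
  · have h1 := hdown i y hy x hxy
    have h2 := hup y hy x hxy
    rw [abs_of_nonpos (sub_nonpos.2 hxy)]
    rw [abs_le]
    constructor <;> nlinarith
  · have h1 := hdown i x hx y hxy
    have h2 := hup x hx y hxy
    rw [abs_of_nonneg (sub_nonneg.2 hxy)]
    rw [abs_le]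
    constructor <;> nlinarith

end Junction

end

/-! ### Doubling of variables on one edge -/

noncomputable section

namespace Junction

open Filter Topology

/-- For a small displacement in the direction of the sign of `a`, the linear term dominates the
quadratic one and would violate the Lipschitz bound if `|a| > L`. -/
theorem LowerJet.abs_slope_le {g : ℝ → ℝ} {x a b L : ℝ} (h : LowerJet g x a b) (hx : x < 0)
    (hL : ∀ x ≤ 0, ∀ y ≤ 0, |g x - g y| ≤ L * |x - y|) : |a| ≤ L := by
  obtain ⟨r, hr, hball⟩ := Metric.eventually_nhds_iff.1 (h.and (gt_mem_nhds hx))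
  have key : ∀ d, |d| < r → a * d + b * d ^ 2 ≤ L * |d| := by
    intro d hd
    obtain ⟨h1, h2⟩ := hball (y := x + d) (by simpa [Real.dist_eq] using hd)
    have h3 := (abs_le.1 (hL (x + d) h2.le x hx.le)).2
    simp only [add_sub_cancel_left] at h1 h3
    linarith
  by_contra! hlt
  have hb := abs_nonneg b
  obtain ⟨d, hd0, hdr, hd⟩ : ∃ d, 0 < d ∧ d < r ∧ |b| * d < |a| - L := by
    have h1 : 0 < (|a| - L) / (|b| + 1) := div_pos (by linarith) (by linarith)
    refine ⟨min (r / 2) ((|a| - L) / (|b| + 1)), lt_min (by linarith) h1,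
      (min_le_left _ _).trans_lt (by linarith), ?_⟩
    have h2 := min_le_right (r / 2) ((|a| - L) / (|b| + 1))
    have h3 : (|a| - L) / (|b| + 1) * (|b| + 1) = |a| - L := by field_simp
    nlinarith
  have hb' := neg_abs_le b
  rcases le_total 0 a with ha | ha
  · have h1 := key d (by rwa [abs_of_pos hd0])
    rw [abs_of_nonneg ha] at *
    rw [abs_of_pos hd0] at h1
    nlinarith
  · have h1 := key (-d) (by rwa [abs_neg, abs_of_pos hd0])
    rw [abs_of_nonpos ha] at *
    rw [abs_neg, abs_of_pos hd0] at h1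
    nlinarith

/-- If `x ↦ g x - t * x` has no local minimum point in `(x₀ - r, 0)` and `t` exceeds the slope of
a lower jet of `g` at `x₀` or at `0`, then `g` lies above the line of slope `t` near `0`. -/
theorem eventually_line_le {g : ℝ → ℝ} {t x₀ q c p d r : ℝ} (hg : ContinuousOn g (Iic 0))
    (hx₀ : x₀ < 0) (hr : 0 < r) (hno : ∀ x ∈ Ioo (x₀ - r) 0, ¬ LowerJet g x t 0)
    (hq : LowerJet g x₀ q c) (hp : ∀ y ≤ 0, g 0 + p * y - d * y ^ 2 ≤ g y)
    (hpq : p < t ∨ q < t) : ∀ᶠ y in 𝓝[≤] (0 : ℝ), g 0 + t * y ≤ g y := by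
  -- If `p < t`, the line of slope `t` falls below the parabola near `0`, because `y ≤ 0`.
  rcases hpq with hpt | hqt
  · have hd : 0 < (t - p) / (|d| + 1) := div_pos (by linarith) (by positivity)
    filter_upwards [self_mem_nhdsWithin, mem_nhdsWithin_of_mem_nhds
      (lt_mem_nhds (show -((t - p) / (|d| + 1)) < 0 by linarith))] with y hy hy1
    have hy0 : y ≤ 0 := hy
    have h1 := hp y hy
    have h2 : (t - p) / (|d| + 1) * (|d| + 1) = t - p := by field_simp
    have h3 : -y * (|d| + 1) ≤ t - p := by
      rw [← h2]; exact mul_le_mul_of_nonneg_right (by linarith) (by positivity)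
    have h4 := le_abs_self d
    nlinarith [mul_nonneg (neg_nonneg.2 hy0) (show 0 ≤ t - p + y * d by nlinarith)]
  · obtain ⟨δ, hδ, hball⟩ := Metric.eventually_nhds_iff.1 hq
    -- As `q < t`, the function `g w - t w` rises when moving left from `x₀`. A point `y` between
    -- `x₀` and `0` below the line would thus force an interior minimum on `[x₁, 0]`: `x₀` beats the
    -- left end and `y` beats `0`.
    obtain ⟨x₁, hx₁r, hx₁0, hx₁⟩ : ∃ x₁, x₀ - r < x₁ ∧ x₁ < x₀ ∧
        g x₀ - t * x₀ < g x₁ - t * x₁ := by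
      have hc := abs_nonneg c
      have h1 : 0 < (t - q) / (|c| + 1) := div_pos (by linarith) (by linarith)
      set τ := min (min (δ / 2) (r / 2)) ((t - q) / (|c| + 1)) with hτ
      have hτ0 : 0 < τ := lt_min (lt_min (by linarith) (by linarith)) h1
      have hτδ : τ ≤ δ / 2 := (min_le_left _ _).trans (min_le_left _ _)
      have hτr : τ ≤ r / 2 := (min_le_left _ _).trans (min_le_right _ _)
      have hτq : τ ≤ (t - q) / (|c| + 1) := min_le_right _ _
      have h3 : (t - q) / (|c| + 1) * (|c| + 1) = t - q := by field_simp
      have h4 := hball (y := x₀ - τ) (by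
        rw [Real.dist_eq, show x₀ - τ - x₀ = -τ by ring, abs_neg, abs_of_pos hτ0]; linarith)
      rw [show x₀ - τ - x₀ = -τ by ring] at h4
      refine ⟨x₀ - τ, by linarith, by linarith, ?_⟩
      have h5 := neg_abs_le c
      have h6 : τ * (|c| + 1) ≤ t - q := by
        rw [← h3]; exact mul_le_mul_of_nonneg_right hτq (by linarith)
      nlinarith [mul_pos hτ0 (show 0 < t - q + τ * c by nlinarith)]
    filter_upwards [self_mem_nhdsWithin, mem_nhdsWithin_of_mem_nhds (lt_mem_nhds hx₀)]
      with y hy hy1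
    by_contra! hlt
    obtain ⟨m, hm, hmin⟩ := (isCompact_Icc (a := x₁) (b := 0)).exists_isMinOn
      ⟨x₀, hx₁0.le, hx₀.le⟩ (f := fun w => g w - t * w)
      ((hg.mono Icc_subset_Iic_self).sub (by fun_prop))
    have hmin' : ∀ w, x₁ ≤ w → w ≤ 0 → g m - t * m ≤ g w - t * w := fun w h1 h2 => hmin ⟨h1, h2⟩
    have hm1 : x₁ < m := by
      rcases hm.1.lt_or_eq with h1 | h1
      · exact h1
      · have := hmin' x₀ hx₁0.le hx₀.le
        rw [← h1] at this
        linarith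
    have hm0 : m < 0 := by
      rcases hm.2.lt_or_eq with h1 | h1
      · exact h1
      · have := hmin' y (by linarith) hy
        rw [h1] at this
        linarith
    refine hno m ⟨by linarith, hm0⟩ ?_
    filter_upwards [gt_mem_nhds hm0, lt_mem_nhds hm1] with w hw0 hw1
    have := hmin' w hw1.le hw0.le
    linarith

/-- A sub-solution `f` and a super-solution `g` of (possibly different) equations with the same
Hamiltonian `h` and with viscosities at most `s ^ 2` on one edge. -/
structure EdgePair (h : ℝ → ℝ → ℝ) (f g : ℝ → ℝ) (L C s ε₁ ε₂ N : ℝ) : Prop where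
  s_pos : 0 < s
  s_le : s ≤ 1
  eps₁_nonneg : 0 ≤ ε₁
  eps₁_le : ε₁ ≤ s ^ 2
  eps₂_nonneg : 0 ≤ ε₂
  eps₂_le : ε₂ ≤ s ^ 2
  L_nonneg : 0 ≤ L
  C_nonneg : 0 ≤ C
  lip : ∀ x ≤ 0, ∀ y ≤ 0, ∀ p q, |p| ≤ L + 1 → |q| ≤ L + 1 →
    |h x p - h y q| ≤ C * (|x - y| + |p - q|)
  lip_f : ∀ x ≤ 0, ∀ y ≤ 0, |f x - f y| ≤ L * |x - y|
  lip_g : ∀ x ≤ 0, ∀ y ≤ 0, |g x - g y| ≤ L * |x - y|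
  bound_f : ∀ x ≤ 0, |f x| ≤ N
  bound_g : ∀ x ≤ 0, |g x| ≤ N
  sub : ∀ x < 0, ∀ a b, UpperJet f x a b → f x - 2 * ε₁ * b + h x a ≤ 0
  super : ∀ x < 0, ∀ a b, LowerJet g x a b → 0 ≤ g x - 2 * ε₂ * b + h x a

namespace EdgePair

variable {h : ℝ → ℝ → ℝ} {f g : ℝ → ℝ} {L C s ε₁ ε₂ N : ℝ}

/-- Reflection exchanges sub- and super-solution together with their viscosities, so doubling can
also keep the other variable off the vertex. -/
theorem neg (P : EdgePair h f g L C s ε₁ ε₂ N) :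
    EdgePair (fun x p => -h x (-p)) (fun x => -g x) (fun x => -f x) L C s ε₂ ε₁ N where
  s_pos := P.s_pos
  s_le := P.s_le
  eps₁_nonneg := P.eps₂_nonneg
  eps₁_le := P.eps₂_le
  eps₂_nonneg := P.eps₁_nonneg
  eps₂_le := P.eps₁_le
  L_nonneg := P.L_nonneg
  C_nonneg := P.C_nonneg
  lip x hx y hy p q hp hq := by
    have := P.lip x hx y hy (-p) (-q) (by rwa [abs_neg]) (by rwa [abs_neg])
    rw [show -p - -q = -(p - q) by ring, abs_neg] at this
    rwa [show -h x (-p) - -h y (-q) = -(h x (-p) - h y (-q)) by ring, abs_neg]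
  lip_f x hx y hy := by
    rw [show -g x - -g y = -(g x - g y) by ring, abs_neg]; exact P.lip_g x hx y hy
  lip_g x hx y hy := by
    rw [show -f x - -f y = -(f x - f y) by ring, abs_neg]; exact P.lip_f x hx y hy
  bound_f x hx := by rw [abs_neg]; exact P.bound_g x hx
  bound_g x hx := by rw [abs_neg]; exact P.bound_f x hx
  sub x hx a b hj := by
    have := P.super x hx _ _ hj.neg_lowerJet
    linarith
  super x hx a b hj := by
    have := P.sub x hx _ _ hj.neg_upperJet
    linarith

theorem continuousOn_g (P : EdgePair h f g L C s ε₁ ε₂ N) : ContinuousOn g (Iic 0) :=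
  (LipschitzOnWith.of_dist_le' (K := L) fun x hx y hy => by
    simpa only [Real.dist_eq] using P.lip_g x hx y hy).continuousOn

theorem continuousOn_f (P : EdgePair h f g L C s ε₁ ε₂ N) : ContinuousOn f (Iic 0) :=
  P.neg.continuousOn_g.neg.congr fun x _ => (neg_neg (f x)).symm

/-- The maximum of the doubled difference on one edge. -/
theorem exists_forall_doubling_le (P : EdgePair h f g L C s ε₁ ε₂ N) {z α κ : ℝ} (hz : z ≤ 0)
    (hα : 0 < α) :
    ∃ x ≤ 0, ∃ y ≤ 0, ∀ x' ≤ 0, ∀ y' ≤ 0,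
      f y' - α * y' ^ 2 - g x' - (x' - y' + κ * s) ^ 2 / (2 * s) ≤
        f y - α * y ^ 2 - g x - (x - y + κ * s) ^ 2 / (2 * s) := by
  have hs := P.s_pos
  set Φ : ℝ × ℝ → ℝ := fun w =>
    f w.2 - α * w.2 ^ 2 - g w.1 - (w.1 - w.2 + κ * s) ^ 2 / (2 * s) with hΦ
  -- Wherever the doubled function exceeds its value at `(z, z)`, each penalty is at most `D`; this
  -- confines `x'` and `y'` to `[-R, 0]`.
  set D := 4 * N + α * z ^ 2 + (κ * s) ^ 2 / (2 * s) with hD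
  have hN : 0 ≤ N := (abs_nonneg _).trans (P.bound_f 0 le_rfl)
  have hD0 : 0 ≤ D := by positivity
  have hDα : 0 ≤ D / α := by positivity
  set R := D / α + 1 + (2 * s * D + 1) + |κ * s| - z with hR
  have hκ := abs_nonneg (κ * s)
  have hsD : 0 ≤ 2 * s * D := by positivity
  have hcont : ContinuousOn Φ (Icc (-R) 0 ×ˢ Icc (-R) 0) := by
    have h1 : ContinuousOn (fun w : ℝ × ℝ => f w.2) (Icc (-R) 0 ×ˢ Icc (-R) 0) :=
      P.continuousOn_f.comp continuousOn_snd fun w hw => hw.2.2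
    have h2 : ContinuousOn (fun w : ℝ × ℝ => g w.1) (Icc (-R) 0 ×ˢ Icc (-R) 0) :=
      P.continuousOn_g.comp continuousOn_fst fun w hw => hw.1.2
    exact ((h1.sub (by fun_prop)).sub h2).sub (by fun_prop)
  have hzR : z ∈ Icc (-R) 0 := ⟨by linarith, hz⟩
  obtain ⟨⟨x, y⟩, ⟨hx, hy⟩, hmax⟩ := (isCompact_Icc.prod isCompact_Icc).exists_isMaxOn
    ⟨(z, z), hzR, hzR⟩ hcont
  refine ⟨x, hx.2, y, hy.2, fun x' hx' y' hy' => ?_⟩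
  change Φ (x', y') ≤ Φ (x, y)
  by_cases hin : -R ≤ x' ∧ -R ≤ y'
  · exact hmax (mk_mem_prod (⟨hin.1, hx'⟩ : x' ∈ Icc (-R) 0) (⟨hin.2, hy'⟩ : y' ∈ Icc (-R) 0))
  refine le_trans ?_ (hmax (mk_mem_prod hzR hzR))
  by_contra! hlt
  simp only [hΦ, sub_self, zero_add] at hlt
  have b1 := abs_le.1 (P.bound_f y' hy')
  have b2 := abs_le.1 (P.bound_g x' hx')
  have b3 := abs_le.1 (P.bound_f z hz)
  have b4 := abs_le.1 (P.bound_g z hz)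
  have e1 : 0 ≤ (x' - y' + κ * s) ^ 2 / (2 * s) := by positivity
  have e2 : 0 ≤ α * y' ^ 2 := by positivity
  have l1 : α * y' ^ 2 ≤ D := by linarith
  have l2 : (x' - y' + κ * s) ^ 2 / (2 * s) ≤ D := by linarith
  rw [div_le_iff₀ (by positivity)] at l2
  have l3 : y' ^ 2 ≤ D / α := by rw [le_div_iff₀ hα]; linarith
  have l4 : |y'| ≤ D / α + 1 := abs_le_of_sq_le_sq (by nlinarith) (by linarith)
  have l5 : |x' - y' + κ * s| ≤ 2 * s * D + 1 :=
    abs_le_of_sq_le_sq (by nlinarith) (by linarith)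
  have l6 := (abs_le.1 l4).1
  have l7 := (abs_le.1 l5).1
  have l8 := le_abs_self (κ * s)
  exact hin ⟨by linarith, by linarith⟩

/-- When `α y² ≤ A`, the last inequality gives `(2 α y)² ≤ s²`: localisation perturbs the slope by
at most `s`. -/
theorem exists_small_penalty {s A : ℝ} (hs : 0 < s) (hs1 : s ≤ 1) (hA : 0 ≤ A) (z : ℝ) :
    ∃ α > 0, α ≤ 1 ∧ α * z ^ 2 ≤ s ∧ 4 * (α * A) ≤ s ^ 2 := by
  have hT : 0 < 4 * A + z ^ 2 + 1 := by positivity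
  have hss : s ^ 2 ≤ s := by nlinarith
  have hα0 : 0 < s ^ 2 / (4 * A + z ^ 2 + 1) := by positivity
  have hαT : s ^ 2 / (4 * A + z ^ 2 + 1) * (4 * A + z ^ 2 + 1) = s ^ 2 := by field_simp
  have h1 : 0 ≤ s ^ 2 / (4 * A + z ^ 2 + 1) * A := by positivity
  have h2 : 0 ≤ s ^ 2 / (4 * A + z ^ 2 + 1) * z ^ 2 := by positivity
  refine ⟨_, hα0, ?_, ?_, ?_⟩ <;> linarith

set_option maxHeartbeats 400000 in
/-- Doubling of variables on one edge with a shift that keeps the variable of the super-solution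
away from the vertex: either the standard estimate holds, or the variable of the sub-solution is
at the vertex. -/
theorem doubling (P : EdgePair h f g L C s ε₁ ε₂ N) {z : ℝ} (hz : z ≤ 0) :
    f z - g z ≤ ((L + 1) ^ 2 + 5 + C * (2 * L + 2)) * s ∨
    ∃ x₀ < 0, ∃ q, |q| ≤ L ∧ -((2 * L + 1) * s) ≤ x₀ ∧ -s ≤ g x₀ + h x₀ q ∧
      (∃ c, LowerJet g x₀ q c) ∧ (∃ c, ∀ y ≤ 0, f y ≤ f 0 + q * y + c * y ^ 2) ∧
      f z - g z ≤ f 0 - g x₀ + ((L + 1) ^ 2 + 1) * s := by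
  have hs := P.s_pos
  have hs1 := P.s_le
  have hL := P.L_nonneg
  have hC := P.C_nonneg
  have hN : 0 ≤ N := (abs_nonneg _).trans (P.bound_f 0 le_rfl)
  set κ := L + 1 with hκ
  have hss : s ^ 2 ≤ s := by nlinarith
  obtain ⟨α, hα0, hα1, hαz, hαN⟩ := exists_small_penalty hs hs1
    (show 0 ≤ 4 * N + 1 + κ ^ 2 by positivity) z
  obtain ⟨x, hx, y, hy, hmax⟩ := P.exists_forall_doubling_le (κ := κ) hz hα0
  set k := 1 / (2 * s) with hk
  have hk0 : 0 < k := by positivity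
  have hks : 2 * k * s = 1 := by rw [hk]; field_simp
  have hmax : ∀ x' ≤ 0, ∀ y' ≤ 0,
      f y' - α * y' ^ 2 - g x' - k * (x' - y' + κ * s) ^ 2 ≤
        f y - α * y ^ 2 - g x - k * (x - y + κ * s) ^ 2 := by
    intro x' hx' y' hy'
    have := hmax x' hx' y' hy'
    rwa [div_eq_inv_mul, div_eq_inv_mul, ← one_div] at this
  -- Were `x = 0`, moving it to `-s` would lower the penalty by at least `(L + 1/2) s`, while `g`
  -- changes by at most `L s`.
  have hx0 : x < 0 := by
    rcases hx.lt_or_eq with h1 | h1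
    · exact h1
    exfalso
    subst h1
    have h1 := hmax (-s) (by linarith) y hy
    have h2 := (abs_le.1 (P.lip_g (-s) (by linarith) 0 le_rfl)).2
    rw [sub_zero, abs_neg, abs_of_pos hs] at h2
    have h3 : k * (-s - y + κ * s) ^ 2 =
        k * (0 - y + κ * s) ^ 2 + y - κ * s + s / 2 := by
      linear_combination (y - κ * s + s / 2) * hks
    rw [hκ] at h1 h3
    linarith
  set q := -(2 * k * (x - y + κ * s)) with hq
  have hjet : LowerJet g x q (-k) := by
    filter_upwards [gt_mem_nhds hx0] with x' hx'
    have := hmax x' (le_of_lt hx') y hy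
    rw [hq]
    linarith
  have hqL : |q| ≤ L := hjet.abs_slope_le hx0 P.lip_g
  have hxy : x - y = -(q * s) - κ * s := by
    rw [hq]; linear_combination (-(x - y + κ * s)) * hks
  have hq' := abs_le.1 hqL
  have hxy' : |x - y| ≤ (2 * L + 1) * s := by
    rw [hxy, abs_le]; constructor <;> nlinarith
  have hval : f z - g z ≤ f y - g x - α * y ^ 2 + (κ ^ 2 + 1) * s := by
    have h1 := hmax z hz z hz
    have h2 : k * (z - z + κ * s) ^ 2 = κ ^ 2 * s / 2 := by
      linear_combination (κ ^ 2 * s / 2) * hks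
    have h3 : 0 ≤ k * (x - y + κ * s) ^ 2 := by positivity
    have h4 : 0 ≤ κ ^ 2 * s := by positivity
    linarith
  have hfjet : ∀ y' ≤ 0, f y' ≤ f y + (q + 2 * α * y) * (y' - y) + (k + α) * (y' - y) ^ 2 := by
    intro y' hy'
    have := hmax x hx y' hy'
    rw [hq]
    linarith
  have hk2 : 2 * s ^ 2 * k = s := by linear_combination s * hks
  have hεk : 2 * ε₂ * k ≤ s := by
    -- The viscous error is of order `ε / s`, hence `O(s)`.
    rw [← hk2]; exact mul_le_mul_of_nonneg_right (by linarith [P.eps₂_le]) hk0.le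
  have hgq := P.super x hx0 q (-k) hjet
  have hαy0 : 0 ≤ α * y ^ 2 := by positivity
  rcases hy.lt_or_eq with hy0 | hy0
  · left
    have hαy : α * y ^ 2 ≤ 4 * N + 1 + κ ^ 2 := by
      have h1 := hmax z hz z hz
      have h2 : k * (z - z + κ * s) ^ 2 = κ ^ 2 * s / 2 := by
        linear_combination (κ ^ 2 * s / 2) * hks
      have h3 : 0 ≤ k * (x - y + κ * s) ^ 2 := by positivity
      have h4 : κ ^ 2 * s ≤ κ ^ 2 := by nlinarith [sq_nonneg κ]
      have h5 : 0 ≤ κ ^ 2 := by positivity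
      have b1 := abs_le.1 (P.bound_f y hy)
      have b2 := abs_le.1 (P.bound_g x hx)
      have b3 := abs_le.1 (P.bound_f z hz)
      have b4 := abs_le.1 (P.bound_g z hz)
      linarith
    have hslope : |2 * α * y| ≤ s := by
      apply abs_le_of_sq_le_sq _ hs.le
      have := mul_le_mul_of_nonneg_left hαy hα0.le
      linarith
    have h1 := P.sub y hy0 (q + 2 * α * y) (k + α) (by
      filter_upwards [gt_mem_nhds hy0] with y' hy'
      exact hfjet y' (le_of_lt hy'))
    have h2 : 2 * ε₁ * (k + α) ≤ 3 * s := by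
      have h3 : 2 * ε₁ * (k + α) ≤ 2 * s ^ 2 * (k + α) :=
        mul_le_mul_of_nonneg_right (by linarith [P.eps₁_le]) (by positivity)
      have h4 : s ^ 2 * α ≤ s := (mul_le_of_le_one_right (sq_nonneg s) hα1).trans hss
      linarith
    have h3 := (abs_le.1 (P.lip x hx y hy q (q + 2 * α * y) (by linarith) (by
      have := abs_add_le q (2 * α * y)
      linarith))).2
    rw [show q - (q + 2 * α * y) = -(2 * α * y) by ring, abs_neg] at h3
    have h4 : C * (|x - y| + |2 * α * y|) ≤ C * ((2 * L + 2) * s) :=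
      mul_le_mul_of_nonneg_left (by linarith) hC
    linarith
  -- At `y = 0` the localisation adds nothing to the slope, so both functions share exactly `q`.
  · right
    subst hy0
    refine ⟨x, hx0, q, hqL, ?_, by linarith, ⟨-k, hjet⟩, ⟨k + α, fun y' hy' => ?_⟩, by linarith⟩
    · have := (abs_le.1 hxy').1
      linarith
    · have := hfjet y' hy'
      rwa [mul_zero, add_zero, sub_zero] at this

/-- If the difference at the vertex is large compared to `s`, then two slopes separate the
sub-solution from the super-solution near the vertex, and the equations hold strictly there with
the signs opposite to those for sub- and super-solutions. -/
theorem exists_separating_slopes (P : EdgePair h f g L C s ε₁ ε₂ N)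
    (hbig : ((L + 1) ^ 2 + 8 + 4 * (L + C) * (2 * L + 2)) * s < f 0 - g 0) :
    ∃ t t', t < t' ∧ ∀ r, r = t ∨ r = t' →
      (∀ᶠ y in 𝓝[≤] (0 : ℝ), f y ≤ f 0 + r * y) ∧
      (∀ᶠ y in 𝓝[≤] (0 : ℝ), g 0 + r * y ≤ g y) ∧
      0 < f 0 + h 0 r ∧ g 0 + h 0 r < 0 := by
  have hs := P.s_pos
  have hs1 := P.s_le
  have hL := P.L_nonneg
  have hC := P.C_nonneg
  have e1 : 0 ≤ (L + 1) ^ 2 * s := by positivity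
  have e2 : 0 ≤ L * (2 * L + 2) * s := by positivity
  have e3 : 0 ≤ C * (2 * L + 2) * s := by positivity
  have hexcl : ¬ f 0 - g 0 ≤ ((L + 1) ^ 2 + 5 + C * (2 * L + 2)) * s := by
    intro hle
    linarith
  obtain ⟨x₀, hx₀, q, hq, hx₀s, hgq, ⟨c₁, hgjet⟩, ⟨c₂, hf0⟩, -⟩ :=
    (P.doubling (z := 0) le_rfl).resolve_left hexcl
  -- The reflected pair puts the variable of `f` off the vertex and that of `g` at it.
  obtain ⟨y₀, hy₀, p', hp, hy₀s, hfp, ⟨c₃, hfjet⟩, ⟨c₄, hg0⟩, -⟩ :=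
    (P.neg.doubling (z := 0) le_rfl).resolve_left (fun hle => hexcl (by linarith))
  obtain ⟨p, rfl⟩ : ∃ p, p' = -p := ⟨-p', by ring⟩
  rw [abs_neg] at hp
  simp only [neg_neg] at hfp hg0
  -- With the midpoint of the two vertex values, `|F r| < s` makes both vertex inequalities strict,
  -- as `f 0 - g 0` exceeds `2 s`.
  set F : ℝ → ℝ := fun r => h 0 r + (f 0 + g 0) / 2 with hF
  -- The radius reaches a further `s` to the left of `x₀` and `y₀`, as needed to exclude interior
  -- touching there.
  have hnear : ∀ x ≤ 0, -((2 * L + 2) * s) ≤ x → ∀ r, |r| ≤ L →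
      |h x r - h 0 r| ≤ C * ((2 * L + 2) * s) ∧ |g x - g 0| ≤ L * ((2 * L + 2) * s) ∧
      |f x - f 0| ≤ L * ((2 * L + 2) * s) := by
    intro x hx hxs r hr
    have h1 : |x - 0| ≤ (2 * L + 2) * s := by
      rw [sub_zero, abs_of_nonpos hx]; linarith
    refine ⟨?_, ?_, ?_⟩
    · have h2 := P.lip x hx 0 le_rfl r r (by linarith) (by linarith)
      rw [sub_self r, abs_zero, add_zero] at h2
      exact h2.trans (mul_le_mul_of_nonneg_left h1 hC)
    · exact (P.lip_g x hx 0 le_rfl).trans (mul_le_mul_of_nonneg_left h1 hL)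
    · exact (P.lip_f x hx 0 le_rfl).trans (mul_le_mul_of_nonneg_left h1 hL)
  have hFq : 0 < F q := by
    obtain ⟨h1, h2, -⟩ := hnear x₀ hx₀.le (by linarith) q hq
    have h3 := (abs_le.1 h1).2
    have h4 := (abs_le.1 h2).2
    simp only [hF]
    linarith
  have hFp : F p < 0 := by
    obtain ⟨h1, -, h2⟩ := hnear y₀ hy₀.le (by linarith) p hp
    have h3 := (abs_le.1 h1).1
    have h4 := (abs_le.1 h2).1
    simp only [hF]
    linarith
  have hFc : ContinuousOn F (Icc (-L) L) := by
    refine ContinuousOn.add ?_ continuousOn_const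
    refine (LipschitzOnWith.of_dist_le' (K := C) fun a ha b hb => ?_).continuousOn
    have h1 := P.lip 0 le_rfl 0 le_rfl a b (by have := abs_le.2 ha; linarith)
      (by have := abs_le.2 hb; linarith)
    rw [sub_self, abs_zero, zero_add] at h1
    simpa only [Real.dist_eq] using h1
  have hsubset : uIcc p q ⊆ Icc (-L) L := uIcc_subset_Icc (abs_le.1 hp) (abs_le.1 hq)
  have hFc' := hFc.mono hsubset
  obtain ⟨t₀, ht₀, hFt₀⟩ : (0 : ℝ) ∈ F '' uIcc p q :=
    intermediate_value_uIcc hFc' (by rw [uIcc_of_le (hFp.trans hFq).le]; exact ⟨hFp.le, hFq.le⟩)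
  have hmem : t₀ ∈ Ioo (min p q) (max p q) := by
    refine ⟨lt_of_le_of_ne ht₀.1 ?_, lt_of_le_of_ne ht₀.2 ?_⟩
    · rintro h1
      rcases min_choice p q with h2 | h2 <;> rw [h2] at h1 <;> rw [← h1] at hFt₀ <;> linarith
    · rintro h1
      rcases max_choice p q with h2 | h2 <;> rw [h2] at h1 <;> rw [h1] at hFt₀ <;> linarith
  -- Both conditions are open at `t₀`, which leaves room for a second slope `t' > t₀`.
  have hopen : ∀ᶠ r in 𝓝 t₀, r ∈ Ioo (min p q) (max p q) ∧ |F r| < s := by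
    have h1 : Ioo (min p q) (max p q) ∈ 𝓝 t₀ := Ioo_mem_nhds hmem.1 hmem.2
    have h2 : ContinuousAt F t₀ := hFc'.continuousAt (Filter.mem_of_superset h1 Ioo_subset_Icc_self)
    have h3 := h2.abs.eventually (gt_mem_nhds (show |F t₀| < s by rw [hFt₀, abs_zero]; exact hs))
    exact Filter.Eventually.and h1 h3
  obtain ⟨t', ht', hlt⟩ := ((hopen.filter_mono nhdsWithin_le_nhds).and
    (self_mem_nhdsWithin (s := Ioi t₀))).exists
  refine ⟨t₀, t', hlt, fun r hr => ?_⟩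
  have hr' : r ∈ Ioo (min p q) (max p q) ∧ |F r| < s := by
    rcases hr with rfl | rfl
    · exact hopen.self_of_nhds
    · exact ht'
  obtain ⟨hrI, hFr⟩ := hr'
  have hrL : |r| ≤ L := abs_le.2 (hsubset (Ioo_subset_Icc_self hrI))
  have hFr1 := (abs_lt.1 hFr).1
  have hFr2 := (abs_lt.1 hFr).2
  simp only [hF] at hFr1 hFr2
  refine ⟨?_, ?_, by linarith, by linarith⟩
  · have h1 := eventually_line_le (t := -r) P.neg.continuousOn_g hy₀ hs (fun x hx hj => by
        obtain ⟨h1, -, h2⟩ := hnear x hx.2.le (by linarith [hx.1]) r hrL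
        have h3 := P.neg.super x hx.2 _ _ hj
        have h4 := (abs_le.1 h1).1
        have h5 := (abs_le.1 h2).1
        simp only [neg_neg] at h3
        linarith) hfjet (p := -q) (d := c₂) (fun y hy => by linarith [hf0 y hy]) (by
        rcases lt_max_iff.1 hrI.2 with h1 | h1
        · right; linarith
        · left; linarith)
    filter_upwards [h1] with y hy
    linarith
  · exact eventually_line_le P.continuousOn_g hx₀ hs (fun x hx hj => by
        obtain ⟨h1, h2, -⟩ := hnear x hx.2.le (by linarith [hx.1]) r hrL
        have h3 := P.super x hx.2 _ _ hj
        have h4 := (abs_le.1 h1).2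
        have h5 := (abs_le.1 h2).2
        linarith) hgjet (p := p) (d := c₄) (fun y hy => by linarith [hg0 y hy])
        (min_lt_iff.1 hrI.1)

end EdgePair

/-! ### Comparison on the network -/

variable {K : ℕ} {ε₁ ε₂ B : ℝ} {H : Fin K → ℝ → ℝ → ℝ} {U V : Fin K → ℝ → ℝ}

/-- The constant in the comparison of Lipschitz sub- and super-solutions. -/
def rate (L C : ℝ) : ℝ := 2 * (L + 1) ^ 2 + 9 + (5 * L + 4 * C) * (2 * L + 2)

theorem JetSub.sub_le [NeZero K] {L C s N : ℝ} (hU : JetSub ε₁ H B U) (hV : JetSuper ε₂ H B V)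
    (hU0 : ∀ i j, U i 0 = U j 0) (hV0 : ∀ i j, V i 0 = V j 0)
    (P : ∀ i, EdgePair (H i) (U i) (V i) L C s ε₁ ε₂ N) (i : Fin K) {z : ℝ} (hz : z ≤ 0) :
    U i z - V i z ≤ rate L C * s := by
  have hs := (P i).s_pos
  have hL := (P i).L_nonneg
  have hC := (P i).C_nonneg
  unfold rate
  by_contra! hlt
  have e1 : 0 ≤ (L + 1) ^ 2 * s := by positivity
  have e2 : 0 ≤ L * (2 * L + 2) * s := by positivity
  have e3 : 0 ≤ C * (2 * L + 2) * s := by positivity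
  obtain ⟨x₀, hx₀, q, -, hx₀s, -, -, -, hval⟩ :=
    ((P i).doubling hz).resolve_left (fun hle => by linarith)
  -- A large difference at `z` passes to the vertex at a cost `O(s)`, since `x₀` is within `(2 L +
  -- 1) s` of it; continuity at the junction carries it to every edge.
  have hbig : ∀ j, ((L + 1) ^ 2 + 8 + 4 * (L + C) * (2 * L + 2)) * s < U j 0 - V j 0 := by
    intro j
    rw [hU0 j i, hV0 j i]
    have h1 := (abs_le.1 ((P i).lip_g x₀ hx₀.le 0 le_rfl)).1
    have h2 : |x₀ - 0| ≤ (2 * L + 1) * s := by rw [sub_zero, abs_of_neg hx₀]; linarith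
    have h3 := mul_le_mul_of_nonneg_left h2 hL
    have h4 : 0 ≤ L * s := by positivity
    linarith
  choose t t' htt ht using fun j => (P j).exists_separating_slopes (hbig j)
  -- The larger slopes test the sub-solution and the smaller ones the super-solution, making the
  -- Kirchhoff inequalities incompatible.
  have h1 := hU.vertex_le t' (fun j => (ht j _ (Or.inr rfl)).1)
    fun j => (ht j _ (Or.inr rfl)).2.2.1
  have h2 := hV.le_vertex t (fun j => (ht j _ (Or.inl rfl)).2.1)
    fun j => (ht j _ (Or.inl rfl)).2.2.2
  have h3 : ∑ j, t j < ∑ j, t' j :=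
    Finset.sum_lt_sum_of_nonempty ⟨i, Finset.mem_univ i⟩ fun j _ => htt j
  linarith

end Junction

end

/-! ### Uniform constants and conclusion -/

noncomputable section

namespace Junction

variable {K : ℕ} {B : ℝ} {H : Fin K → ℝ → ℝ → ℝ}

theorem exists_uniform_lipschitz
    (hcont : ∀ i, ∀ R > 0, ∃ L : NNReal,
      LipschitzOnWith L (fun q : ℝ × ℝ => H i q.1 q.2) (Set.Iic 0 ×ˢ Metric.ball 0 R))
    {R : ℝ} (hR : 0 ≤ R) :
    ∃ C ≥ 0, ∀ i, ∀ x ≤ 0, ∀ y ≤ 0, ∀ p q, |p| ≤ R → |q| ≤ R →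
      |H i x p - H i y q| ≤ C * (|x - y| + |p - q|) := by
  choose L hL using fun i => hcont i (R + 1) (by linarith)
  refine ⟨∑ i, (L i : ℝ), Finset.sum_nonneg fun i _ => (L i).2, ?_⟩
  intro i x hx y hy p q hp hq
  have hball : ∀ r : ℝ, |r| ≤ R → r ∈ Metric.ball (0 : ℝ) (R + 1) := fun r hr => by
    rw [mem_ball_zero_iff, Real.norm_eq_abs]; linarith
  have h1 := (hL i).dist_le_mul (x, p) ⟨hx, hball p hp⟩ (y, q) ⟨hy, hball q hq⟩
  rw [Real.dist_eq, Prod.dist_eq, Real.dist_eq, Real.dist_eq] at h1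
  refine h1.trans (mul_le_mul ?_ (max_le_add_of_nonneg (abs_nonneg _) (abs_nonneg _))
    (le_max_of_le_left (abs_nonneg _)) (Finset.sum_nonneg fun i _ => (L i).2))
  exact Finset.single_le_sum (f := fun i => (L i : ℝ)) (fun i _ => (L i).2) (Finset.mem_univ i)

theorem exists_uniform_bound
    (hcont : ∀ i, ∀ R > 0, ∃ L : NNReal,
      LipschitzOnWith L (fun q : ℝ × ℝ => H i q.1 q.2) (Set.Iic 0 ×ˢ Metric.ball 0 R))
    (hbdd : ∃ M : ℝ, ∀ i, ∀ x ≤ 0, |H i x 0| ≤ M) {R : ℝ} (hR : 0 ≤ R) :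
    ∃ A ≥ 0, ∀ i, ∀ x ≤ 0, ∀ p, |p| ≤ R → |H i x p| ≤ A := by
  obtain ⟨C, hC, hlip⟩ := exists_uniform_lipschitz hcont hR
  obtain ⟨M, hM⟩ := hbdd
  refine ⟨|M| + C * R, by positivity, fun i x hx p hp => ?_⟩
  have h1 := hlip i x hx x hx p 0 hp (by rwa [abs_zero])
  rw [sub_self, abs_zero, zero_add, sub_zero] at h1
  have h2 := abs_sub_abs_le_abs_sub (H i x p) (H i x 0)
  have h3 := hM i x hx
  have h4 := le_abs_self M
  have h5 := mul_le_mul_of_nonneg_left hp hC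
  linarith

/-- The restrictions to the edges of a bounded continuous solution. -/
structure BoundedJetSolution (ε : ℝ) (H : Fin K → ℝ → ℝ → ℝ) (B : ℝ) (U : Fin K → ℝ → ℝ) :
    Prop where
  sub : JetSub ε H B U
  super : JetSuper ε H B U
  eq_zero : ∀ i j, U i 0 = U j 0
  continuousOn : ∀ i, ContinuousOn (U i) (Iic 0)
  bounded : ∃ M, ∀ i, ∀ x ≤ 0, |U i x| ≤ M

theorem boundedJetSolution_of {ε : ℝ} {u : Network K → ℝ} (hc : Continuous u) (hb : IsBounded u)
    (h1 : JetSub ε H B (fun i x => u (edge i x))) (h2 : JetSuper ε H B (fun i x => u (edge i x))) :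
    BoundedJetSolution ε H B (fun i x => u (edge i x)) where
  sub := h1
  super := h2
  eq_zero i j := congrArg u (edge_zero i j)
  continuousOn i := (hc.comp (continuous_edge i)).continuousOn
  bounded := by
    obtain ⟨M, hM⟩ := hb
    exact ⟨M, fun i x _ => hM _⟩

theorem BoundedJetSolution.abs_apply_le [NeZero K] {ε A : ℝ} {U : Fin K → ℝ → ℝ}
    (h : BoundedJetSolution ε H B U) (hε : 0 ≤ ε)
    (hA : ∀ i, ∀ x ≤ 0, ∀ p, |p| ≤ |B| + 4 → |H i x p| ≤ A) (i : Fin K) {x : ℝ} (hx : x ≤ 0) :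
    |U i x| ≤ A + ((|B| + 2) ^ 2 + 3) * (1 + √ε) := by
  obtain ⟨M, hM⟩ := h.bounded
  have h1 := h.super.lower_bound hε h.eq_zero h.continuousOn
    (fun j y hy => (abs_le.1 (hM j y hy)).1) hA i hx
  have h2 := h.sub.neg.lower_bound (m := -M) (A := A) hε
    (fun j k => congrArg _ (h.eq_zero j k)) (fun j => (h.continuousOn j).neg)
    (fun j y hy => by have := (abs_le.1 (hM j y hy)).2; linarith)
    (fun j y hy p hp => by
      rw [abs_neg] at hp
      simpa only [reflect, abs_neg] using hA j y hy (-p) (by rwa [abs_neg])) i hx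
  rw [abs_neg] at h2
  exact abs_le.2 ⟨h1, by linarith⟩

/-- Comparison in both directions between solutions with viscosities `0` and `ε ≤ 1`. -/
theorem BoundedJetSolution.abs_apply_sub_le [NeZero K] {ε L C N : ℝ} {U V : Fin K → ℝ → ℝ}
    (hU : BoundedJetSolution 0 H B U) (hV : BoundedJetSolution ε H B V) (hε : 0 < ε) (hε1 : ε ≤ 1)
    (hL : 0 ≤ L) (hC : 0 ≤ C)
    (hlip : ∀ i, ∀ x ≤ 0, ∀ y ≤ 0, ∀ p q, |p| ≤ L + 1 → |q| ≤ L + 1 →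
      |H i x p - H i y q| ≤ C * (|x - y| + |p - q|))
    (hUL : ∀ i, ∀ x ≤ 0, ∀ y ≤ 0, |U i x - U i y| ≤ L * |x - y|)
    (hVL : ∀ i, ∀ x ≤ 0, ∀ y ≤ 0, |V i x - V i y| ≤ L * |x - y|)
    (hUN : ∀ i, ∀ x ≤ 0, |U i x| ≤ N) (hVN : ∀ i, ∀ x ≤ 0, |V i x| ≤ N)
    (i : Fin K) {z : ℝ} (hz : z ≤ 0) : |V i z - U i z| ≤ rate L C * √ε := by
  have hs : 0 < √ε := Real.sqrt_pos.2 hε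
  have hs1 : √ε ≤ 1 := Real.sqrt_le_one.2 hε1
  have hs2 : √ε ^ 2 = ε := Real.sq_sqrt hε.le
  have hUV := hU.sub.sub_le hV.super hU.eq_zero hV.eq_zero (L := L) (C := C) (s := √ε) (N := N)
    (fun j => ⟨hs, hs1, le_rfl, by positivity, hε.le, hs2.ge, hL, hC, hlip j, hUL j, hVL j,
      hUN j, hVN j, hU.sub.edge_le j, hV.super.le_edge j⟩) i hz
  have hVU := hV.sub.sub_le hU.super hV.eq_zero hU.eq_zero (L := L) (C := C) (s := √ε) (N := N)
    (fun j => ⟨hs, hs1, hε.le, hs2.ge, le_rfl, by positivity, hL, hC, hlip j, hVL j, hUL j,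
      hVN j, hUN j, hV.sub.edge_le j, hU.super.le_edge j⟩) i hz
  exact abs_le.2 ⟨by linarith, hVU⟩

end Junction

end

theorem theorem1 (K : ℕ) [NeZero K] (H : Fin K → ℝ → ℝ → ℝ) (B : ℝ)
    -- each `H i` is Lipschitz on `(-∞, 0] × B(0, R)`, for every `R`
    (hcont : ∀ i, ∀ R > 0, ∃ L : NNReal,
      LipschitzOnWith L (fun q : ℝ × ℝ => H i q.1 q.2) (Set.Iic 0 ×ˢ Metric.ball 0 R))
    -- coercivity, uniformly in `x`
    (hcoer : ∀ i, ∀ A : ℝ, ∃ P : ℝ, ∀ x ≤ 0, ∀ p, P ≤ |p| → A ≤ H i x p)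
    -- Lipschitz dependence on `x`
    (hlip : ∀ R > 0, ∃ C > 0, ∀ i, ∀ x ≤ 0, ∀ y ≤ 0, ∀ p : ℝ, |p| ≤ R →
      |H i x p - H i y p| ≤ C * (1 + |p|) * |x - y|)
    -- boundedness of `H i x 0`
    (hbdd : ∃ M : ℝ, ∀ i, ∀ x ≤ 0, |H i x 0| ≤ M) :
    ∃ C > 0, ∀ u : Junction.Network K → ℝ,
      Junction.IsSolution H B u → Junction.IsBounded u →
      ∀ ε > 0, ∀ uε : Junction.Network K → ℝ,
        Junction.IsViscousSolution ε H B uε → Junction.IsBounded uε →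
        ∀ z, |uε z - u z| ≤ C * ε ^ (1 / 2 : ℝ) := by
  obtain ⟨A, hA0, hA⟩ := Junction.exists_uniform_bound hcont hbdd
    (R := |B| + 4) (by positivity)
  set b := (|B| + 2) ^ 2 + 3 with hb
  have hb0 : 0 < b := by positivity
  -- The a priori bound at `ε = 1`, valid for all `ε ≤ 1`.
  set M := A + b * 2 with hM
  choose P hP using fun i => hcoer i (M + 1)
  set Q := 1 + ∑ i, |P i| with hQ
  have hPQ : ∀ i, P i ≤ Q := fun i => by
    have h1 := Finset.single_le_sum (f := fun i => |P i|) (fun i _ => abs_nonneg _)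
      (Finset.mem_univ i)
    have h2 := le_abs_self (P i)
    linarith
  have hQ0 : 0 < Q := by
    have := Finset.sum_nonneg (s := Finset.univ) fun i _ => abs_nonneg (P i)
    linarith
  set L := Q * K + |B| + 1 with hL
  have hL0 : 0 ≤ L := by positivity
  obtain ⟨C, hC0, hC⟩ := Junction.exists_uniform_lipschitz hcont (R := L + 1) (by positivity)
  have hrate : 0 < Junction.rate L C := by unfold Junction.rate; positivity
  refine ⟨Junction.rate L C + (2 * A + 3 * b), by positivity, ?_⟩
  intro u hu hub ε hε uε huε huεb z
  rw [← Real.sqrt_eq_rpow]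
  have hU := Junction.boundedJetSolution_of hu.1 hub hu.2.1.jetSub hu.2.2.jetSuper
  have hV := Junction.boundedJetSolution_of huε.1 huεb huε.2.1.jetSub huε.2.2.jetSuper
  obtain ⟨i, x, hx, rfl⟩ := Junction.exists_eq_edge z
  have hs0 := Real.sqrt_nonneg ε
  have hUb := fun j (y : ℝ) (hy : y ≤ 0) => hU.abs_apply_le le_rfl hA j hy
  have hVb := fun j (y : ℝ) (hy : y ≤ 0) => hV.abs_apply_le hε.le hA j hy
  simp only [Real.sqrt_zero, add_zero, mul_one] at hUb
  rcases le_total ε 1 with hε1 | hε1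
  · have hs1 : √ε ≤ 1 := Real.sqrt_le_one.2 hε1
    have hUM : ∀ j, ∀ y ≤ 0, |u (Junction.edge j y)| ≤ M := fun j y hy =>
      (hUb j y hy).trans (by linarith)
    have hVM : ∀ j, ∀ y ≤ 0, |uε (Junction.edge j y)| ≤ M := fun j y hy =>
      (hVb j y hy).trans (by
        have := mul_le_mul_of_nonneg_left (show 1 + √ε ≤ 2 by linarith) hb0.le
        linarith)
    have hH : ∀ j, ∀ y ≤ 0, ∀ p, Q ≤ |p| → M < H j y p := fun j y hy p hp => by
      have := hP j y hy p ((hPQ j).trans hp)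
      linarith
    have h1 := hU.abs_apply_sub_le hV hε hε1 hL0 hC0 hC
      (fun j y hy w hw => hU.sub.lipschitz hU.continuousOn
        (fun k y hy => (abs_le.1 (hUM k y hy)).2) (fun k y hy => (abs_le.1 (hUM k y hy)).1)
        hQ0 hH j hy hw)
      (fun j y hy w hw => hV.sub.lipschitz hV.continuousOn
        (fun k y hy => (abs_le.1 (hVM k y hy)).2) (fun k y hy => (abs_le.1 (hVM k y hy)).1)
        hQ0 hH j hy hw) hUM hVM i hx
    refine h1.trans (mul_le_mul_of_nonneg_right ?_ hs0)
    have : 0 ≤ 2 * A + 3 * b := by positivity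
    linarith
  -- For `ε ≥ 1` the a priori bounds are already `O(√ε)`.
  · have hs1 : 1 ≤ √ε := Real.one_le_sqrt.2 hε1
    have h1 := hUb i x hx
    have h2 := hVb i x hx
    have h3 := abs_sub (uε (Junction.edge i x)) (u (Junction.edge i x))
    have h4 : 2 * A + 2 * b ≤ (2 * A + 2 * b) * √ε := le_mul_of_one_le_right (by positivity) hs1
    have h5 : 0 ≤ Junction.rate L C * √ε := by positivity
    linarith
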